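/- **Theorem 1.4.** Let $\mathcal G$ be a real Lie algebra and let $r\in\wedge^2\mathcal G$. Denote also by $r:\mathcal G^*\to\mathcal G$ the linear map given by $\alpha(r(\beta))=r(\alpha,\beta)$. Suppose that $r$ is a solution of the classical Yang–Baxter equation, i.e. $$\alpha([r(\beta),r(\gamma)])+\beta([r(\gamma),r(\alpha)])+\gamma([r(\alpha),r(\beta)])=0\qquad\text{for all }\alpha,\beta,\gamma\in\mathcal G^*,$$ and that $r$ is unimodular, i.e. for every $u$ in the Lie subalgebra $\operatorname{Im} r\subset\mathcal G$ the endomorphism $\operatorname{ad}_u:\operatorname{Im} r\to\operatorname{Im} r$, $v\mapsto[u,v]$, has trace zero. Let $(M,g)$ be a (smooth, Hausdorff, finite-dimensional) Riemannian manifold without boundary and let $\Gamma:\mathcal G\to\mathcal X(M)$ be an action of $\mathcal G$ on $M$, i.e. a morphism of Lie algebras into the Lie algebra of smooth vector fields on $M$, which is locally free (for every $x\in M$ the map $\mathcal G\to T_xM$, $u\mapsto\Gamma(u)(x)$, is injective) and such that $\Gamma(u)$ is a Killing vector field of $(M,g)$ for every $u\in\mathcal G$. Let $\pi:=\Gamma(r)$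 be the induced bivector field, given at $x$ by the image of $r$ under $\wedge^2\mathcal G\to\wedge^2T_xM$. Then $\pi$ is a Killing–Poisson tensor on $(M,g)$, that is: 1. $\pi$ is a (smooth) Poisson tensor: the bracket $\{f,h\}=\pi(df,dh)$ on $C^\infty(M)$ satisfies the Jacobi identity; 2. the divergence of $\pi$ with respect to the Levi-Civita connection $\nabla$, i.e. the vector field obtained by contracting $\nabla\pi$, vanishes; 3. for every open set $U\subset M$ and every $f\in C^\infty(U)$ which is a Casimir function on $U$ (its Hamiltonian vector field $H_f=\{f,\cdot\}$ vanishes on $U$), one has $L_{\nabla f}\pi=0$ on $U$, where $\nabla f$ is the gradient of $f$ with respect to $g$. -/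

import Mathlib

open Bundle
open scoped Manifold ContDiff

namespace KillingPoisson

/-! ## Bivectors on a vector space -/

section Algebra

variable {V : Type*} [AddCommGroup V] [Module ℝ V]

/-- The linear map `V* → V` attached to a bivector `r`, written `r` again in the literature:
for `r = u ∧ v` it is `β ↦ β(v) u - β(u) v`, so that
`α (r β) = α(u) β(v) - α(v) β(u) = r(α, β)`. -/
noncomputable def sharp : ⋀[ℝ]^2 V →ₗ[ℝ] (Module.Dual ℝ V →ₗ[ℝ] V) :=
  exteriorPower.alternatingMapLinearEquiv
    { toFun := fun w ↦
        ((LinearMap.applyₗ (w 1) : Module.Dual ℝ V →ₗ[ℝ] ℝ).smulRight (w 0) -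
          (LinearMap.applyₗ (w 0) : Module.Dual ℝ V →ₗ[ℝ] ℝ).smulRight (w 1))
      map_update_add' := by
        intro _ w i x y
        ext β
        fin_cases i <;> simp [add_smul] <;> abel
      map_update_smul' := by
        intro _ w i c x
        ext β
        fin_cases i <;> simp [smul_sub, smul_smul, mul_comm]
      map_eq_zero_of_eq' := by
        intro w i j h hij
        fin_cases i <;> fin_cases j <;> simp_all }

/-- The value `r(α, β)` of a bivector on two covectors. -/
noncomputable def pair (r : ⋀[ℝ]^2 V) (α β : Module.Dual ℝ V) : ℝ := α (sharp r β)

theorem sharp_wedge (u v : V) (β : Module.Dual ℝ V) :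
    sharp (exteriorPower.ιMulti ℝ 2 ![u, v]) β = β v • u - β u • v := by
  simp [sharp]

theorem pair_swap (r : ⋀[ℝ]^2 V) (α β : Module.Dual ℝ V) : pair r α β = - pair r β α := by
  have hr : r ∈ Submodule.span ℝ (Set.range (exteriorPower.ιMulti ℝ 2 (M := V))) := by
    rw [exteriorPower.ιMulti_span]; trivial
  induction hr using Submodule.span_induction with
  | mem x h =>
    obtain ⟨w, rfl⟩ := h
    have hw : w = ![w 0, w 1] := by ext i; fin_cases i <;> rfl
    rw [hw]
    simp only [pair, sharp_wedge, map_sub, map_smul, smul_eq_mul]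
    ring
  | zero => simp [pair]
  | add x y _ _ hx hy => simp only [pair, map_add, LinearMap.add_apply] at *; linarith
  | smul c x _ hx => simp only [pair, map_smul, LinearMap.smul_apply, smul_eq_mul] at *; rw [hx]; ring

end Algebra

/-! ## The classical Yang-Baxter equation -/

section YangBaxter

variable {L : Type*} [LieRing L] [LieAlgebra ℝ L]

/-- `r` solves the classical Yang-Baxter equation `[r, r] = 0`, where
`[r,r](α,β,γ) = α([r β, r γ]) + β([r γ, r α]) + γ([r α, r β])`. -/
def IsYangBaxter (r : ⋀[ℝ]^2 L) : Prop :=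
  ∀ α β γ : Module.Dual ℝ L,
    α ⁅sharp r β, sharp r γ⁆ + β ⁅sharp r γ, sharp r α⁆ + γ ⁅sharp r α, sharp r β⁆ = 0

/-- The image of a solution of the classical Yang-Baxter equation is a Lie subalgebra. -/
theorem IsYangBaxter.lie_mem_range {r : ⋀[ℝ]^2 L} (hr : IsYangBaxter r) {u v : L}
    (hu : u ∈ LinearMap.range (sharp r)) (hv : v ∈ LinearMap.range (sharp r)) :
    ⁅u, v⁆ ∈ LinearMap.range (sharp r) := by
  obtain ⟨β, rfl⟩ := hu
  obtain ⟨γ, rfl⟩ := hv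
  refine ⟨β.comp (LieAlgebra.ad ℝ L (sharp r γ)) - γ.comp (LieAlgebra.ad ℝ L (sharp r β)), ?_⟩
  rw [← sub_eq_zero, ← Module.forall_dual_apply_eq_zero_iff ℝ]
  intro α
  have h := hr α β γ
  have h₁ := pair_swap r α (β.comp (LieAlgebra.ad ℝ L (sharp r γ)))
  have h₂ := pair_swap r α (γ.comp (LieAlgebra.ad ℝ L (sharp r β)))
  have h₃ : ⁅sharp r α, sharp r β⁆ = -⁅sharp r β, sharp r α⁆ := (lie_skew _ _).symm
  simp only [pair, LinearMap.comp_apply, LieAlgebra.ad_apply] at h₁ h₂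
  rw [h₃] at h
  simp only [map_sub, map_neg] at h ⊢
  linarith

/-- The Lie subalgebra `Im r` of `L`. -/
noncomputable def imageSubalgebra (r : ⋀[ℝ]^2 L) (hr : IsYangBaxter r) : LieSubalgebra ℝ L :=
  { LinearMap.range (sharp r) with
    lie_mem' := fun hu hv ↦ hr.lie_mem_range hu hv }

/-- A Lie algebra is unimodular if `ad u` has trace zero for all `u`. -/
def IsUnimodularLieAlgebra (K : Type*) [LieRing K] [LieAlgebra ℝ K] : Prop :=
  ∀ u : K, LinearMap.trace ℝ K (LieAlgebra.ad ℝ K u) = 0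

end YangBaxter

/-! ## Riemannian metrics and the Levi-Civita connection -/

section Riemannian

variable
  {E : Type*} [NormedAddCommGroup E] [NormedSpace ℝ E] [FiniteDimensional ℝ E]
  {H : Type*} [TopologicalSpace H] {I : ModelWithCorners ℝ E H}
  {M : Type*} [TopologicalSpace M] [ChartedSpace H M] [IsManifold I ∞ M]

instance instFiniteDimensionalTangentSpace (x : M) : FiniteDimensional ℝ (TangentSpace I x) :=
  inferInstanceAs (FiniteDimensional ℝ E)

variable (g : ContMDiffRiemannianMetric I ∞ E (fun x : M ↦ TangentSpace I x))

/-- The isomorphism `v ↦ g(v, ·)` from tangent vectors to covectors. -/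
noncomputable def flat (x : M) : TangentSpace I x ≃ₗ[ℝ] Module.Dual ℝ (TangentSpace I x) :=
  LinearMap.linearEquivOfInjective
    (ContinuousLinearMap.coeLM ℝ ∘ₗ (g.inner x).toLinearMap)
    (by
      rw [injective_iff_map_eq_zero]
      intro v hv
      by_contra hne
      have h := g.pos x v hne
      have h' : g.inner x v v = 0 := congrArg (fun φ : Module.Dual ℝ (TangentSpace I x) ↦ φ v) hv
      exact h.ne' h')
    Subspace.dual_finrank_eq.symm

theorem flat_apply (x : M) (v w : TangentSpace I x) : flat g x v w = g.inner x v w := rfl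

theorem inner_flat_symm (x : M) (φ : Module.Dual ℝ (TangentSpace I x)) (w : TangentSpace I x) :
    g.inner x ((flat g x).symm φ) w = φ w := by
  rw [← flat_apply, LinearEquiv.apply_symm_apply]

/-- The gradient of a function: `g(∇f, Y) = df(Y)`. -/
noncomputable def gradient (f : M → ℝ) (x : M) : TangentSpace I x :=
  (flat g x).symm (d% f x : TangentSpace I x →L[ℝ] ℝ)

theorem mdifferentiableAt_inner {Y Z : Π x : M, TangentSpace I x} {x : M}
    (hY : MDiffAt (T% Y) x) (hZ : MDiffAt (T% Z) x) :
    MDiffAt (fun y ↦ g.inner y (Y y) (Z y)) x := by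
  have hg := (g.contMDiff x).mdifferentiableAt (by simp)
  have h := MDifferentiableAt.clm_bundle_apply₂ (E₃ := Bundle.Trivial M ℝ) hg hY hZ
  simp only [mdifferentiableAt_totalSpace] at h
  exact h.2

/-- The right-hand side of Koszul's formula for `2 g(∇_X Y, Z)`. -/
noncomputable def koszul (X Y Z : Π x : M, TangentSpace I x) (x : M) : ℝ :=
  d% (fun y ↦ g.inner y (Y y) (Z y)) x (X x) + d% (fun y ↦ g.inner y (X y) (Z y)) x (Y x)
    - d% (fun y ↦ g.inner y (X y) (Y y)) x (Z x)
    + g.inner x (VectorField.mlieBracket I X Y x) (Z x)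
    - g.inner x (VectorField.mlieBracket I X Z x) (Y x)
    - g.inner x (VectorField.mlieBracket I Y Z x) (X x)

theorem koszul_tensorial_left {x : M} {Y Z : Π x : M, TangentSpace I x}
    (hY : MDiffAt (T% Y) x) (hZ : MDiffAt (T% Z) x) :
    TensorialAt I E (fun X ↦ koszul g X Y Z x) x where
  smul {f X} hf hX := by
    have := FiniteDimensional.complete ℝ E
    simp [koszul, VectorField.mlieBracket_smul_left hf hX,
      mvfderiv_fun_mul hf (mdifferentiableAt_inner g hX hZ),
      mvfderiv_fun_mul hf (mdifferentiableAt_inner g hX hY)]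
    rw [g.symm x (X x) (Z x), g.symm x (X x) (Y x)]
    ring
  add {X X'} hX hX' := by
    have := FiniteDimensional.complete ℝ E
    simp [koszul, VectorField.mlieBracket_add_left hX hX',
      mvfderiv_fun_add (mdifferentiableAt_inner g hX hZ) (mdifferentiableAt_inner g hX' hZ),
      mvfderiv_fun_add (mdifferentiableAt_inner g hX hY) (mdifferentiableAt_inner g hX' hY)]
    ring

theorem koszul_tensorial_right {x : M} {X Y : Π x : M, TangentSpace I x}
    (hX : MDiffAt (T% X) x) (hY : MDiffAt (T% Y) x) :
    TensorialAt I E (fun Z ↦ koszul g X Y Z x) x where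
  smul {f Z} hf hZ := by
    have := FiniteDimensional.complete ℝ E
    simp [koszul, VectorField.mlieBracket_smul_right hf hZ,
      mvfderiv_fun_mul hf (mdifferentiableAt_inner g hX hZ),
      mvfderiv_fun_mul hf (mdifferentiableAt_inner g hY hZ)]
    rw [g.symm x (Z x) (X x), g.symm x (Z x) (Y x)]
    ring
  add {Z Z'} hZ hZ' := by
    have := FiniteDimensional.complete ℝ E
    simp [koszul, VectorField.mlieBracket_add_right hZ hZ',
      mvfderiv_fun_add (mdifferentiableAt_inner g hX hZ) (mdifferentiableAt_inner g hX hZ'),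
      mvfderiv_fun_add (mdifferentiableAt_inner g hY hZ) (mdifferentiableAt_inner g hY hZ')]
    ring

open Classical in
/-- The Levi-Civita covariant derivative of `Y` at `x`, as a linear map `v ↦ ∇_v Y`, defined by
Koszul's formula (and by `0` if `Y` is not differentiable at `x`). -/
noncomputable def leviCivitaFun (Y : Π x : M, TangentSpace I x) (x : M) :
    TangentSpace I x →L[ℝ] TangentSpace I x :=
  have : T2Space (TangentSpace I x) := inferInstanceAs (T2Space E)
  if hY : MDiffAt (T% Y) x then
    (2⁻¹ : ℝ) • LinearMap.toContinuousLinearMap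
      ((flat g x).symm.toLinearMap ∘ₗ ContinuousLinearMap.coeLM ℝ ∘ₗ
        (TensorialAt.mkHom₂ (fun X Z ↦ koszul g X Y Z x) x
          (fun _ hZ ↦ koszul_tensorial_left g hY hZ)
          (fun _ hX ↦ koszul_tensorial_right g hX hY)).toLinearMap)
  else 0

/-- Koszul's formula `2 g(∇_X Y, Z) = ...`. -/
theorem two_inner_leviCivitaFun {X Y Z : Π x : M, TangentSpace I x} {x : M}
    (hX : MDiffAt (T% X) x) (hY : MDiffAt (T% Y) x) (hZ : MDiffAt (T% Z) x) :
    2 * g.inner x (leviCivitaFun g Y x (X x)) (Z x) = koszul g X Y Z x := by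
  simp only [leviCivitaFun, hY, dite_true]
  simp [inner_flat_symm]
  exact TensorialAt.mkHom₂_apply _ _ hX hZ

theorem eq_of_inner_eq {x : M} {v w : TangentSpace I x}
    (h : ∀ Z : Π x : M, TangentSpace I x, MDiffAt (T% Z) x →
      g.inner x v (Z x) = g.inner x w (Z x)) : v = w := by
  apply (flat g x).injective
  ext z
  have := h (FiberBundle.extend E z) (FiberBundle.mdifferentiableAt_extend I E _)
  simpa [flat_apply] using this

/-- The Levi-Civita connection of a Riemannian metric. -/
noncomputable def leviCivita : CovariantDerivative I E (TangentSpace I : M → Type _) where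
  toFun := leviCivitaFun g
  isCovariantDerivativeOnUniv :=
    { add := by
        intro Y Y' x hY hY' _
        ext v
        obtain ⟨X, hX, rfl⟩ : ∃ X : Π x : M, TangentSpace I x, MDiffAt (T% X) x ∧ X x = v :=
          ⟨FiberBundle.extend E v, FiberBundle.mdifferentiableAt_extend I E _, by simp⟩
        refine eq_of_inner_eq g fun Z hZ ↦ mul_left_cancel₀ (two_ne_zero (α := ℝ)) ?_
        have := FiniteDimensional.complete ℝ E
        rw [two_inner_leviCivitaFun g hX (mdifferentiableAt_add_section hY hY') hZ]
        simp only [_root_.add_apply, map_add, mul_add,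
          two_inner_leviCivitaFun g hX hY hZ, two_inner_leviCivitaFun g hX hY' hZ]
        simp [koszul, VectorField.mlieBracket_add_left hY hY',
          VectorField.mlieBracket_add_right hY hY',
          mvfderiv_fun_add (mdifferentiableAt_inner g hX hY) (mdifferentiableAt_inner g hX hY'),
          mvfderiv_fun_add (mdifferentiableAt_inner g hY hZ) (mdifferentiableAt_inner g hY' hZ)]
        ring
      leibniz := by
        intro Y f x hY hf _
        ext v
        obtain ⟨X, hX, rfl⟩ : ∃ X : Π x : M, TangentSpace I x, MDiffAt (T% X) x ∧ X x = v :=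
          ⟨FiberBundle.extend E v, FiberBundle.mdifferentiableAt_extend I E _, by simp⟩
        refine eq_of_inner_eq g fun Z hZ ↦ mul_left_cancel₀ (two_ne_zero (α := ℝ)) ?_
        have := FiniteDimensional.complete ℝ E
        rw [two_inner_leviCivitaFun g hX (hf.smul_section hY) hZ]
        have h := two_inner_leviCivitaFun g hX hY hZ
        simp only [koszul] at h
        simp [koszul, VectorField.mlieBracket_smul_left hf hY,
          VectorField.mlieBracket_smul_right hf hY,
          mvfderiv_fun_mul hf (mdifferentiableAt_inner g hX hY),
          mvfderiv_fun_mul hf (mdifferentiableAt_inner g hY hZ)]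
        rw [g.symm x (X x) (Y x)]
        linear_combination (-f x) * h }

theorem leviCivita_apply (Y : Π x : M, TangentSpace I x) (x : M) :
    leviCivita g Y x = leviCivitaFun g Y x := rfl

/-- The Levi-Civita connection preserves the metric. -/
theorem leviCivita_metric {Y Z : Π x : M, TangentSpace I x} {x : M} (v : TangentSpace I x)
    (hY : MDiffAt (T% Y) x) (hZ : MDiffAt (T% Z) x) :
    d% (fun y ↦ g.inner y (Y y) (Z y)) x v =
      g.inner x (leviCivita g Y x v) (Z x) + g.inner x (Y x) (leviCivita g Z x v) := by
  obtain ⟨X, hX, rfl⟩ : ∃ X : Π x : M, TangentSpace I x, MDiffAt (T% X) x ∧ X x = v :=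
    ⟨FiberBundle.extend E v, FiberBundle.mdifferentiableAt_extend I E _, by simp⟩
  have h₁ := two_inner_leviCivitaFun g hX hY hZ
  have h₂ := two_inner_leviCivitaFun g hX hZ hY
  have hs : (fun y ↦ g.inner y (Z y) (Y y)) = fun y ↦ g.inner y (Y y) (Z y) :=
    funext fun y ↦ g.symm y _ _
  rw [leviCivita_apply, leviCivita_apply, g.symm x (Y x)]
  simp only [koszul, hs, VectorField.mlieBracket_swap_apply (V := Z) (W := Y), map_neg,
    _root_.neg_apply] at h₁ h₂
  linarith

/-- The Levi-Civita connection is torsion-free. -/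
theorem leviCivita_torsionFree {X Y : Π x : M, TangentSpace I x} {x : M}
    (hX : MDiffAt (T% X) x) (hY : MDiffAt (T% Y) x) :
    leviCivita g Y x (X x) - leviCivita g X x (Y x) = VectorField.mlieBracket I X Y x := by
  refine eq_of_inner_eq g fun Z hZ ↦ ?_
  have h₁ := two_inner_leviCivitaFun g hX hY hZ
  have h₂ := two_inner_leviCivitaFun g hY hX hZ
  have hs : (fun y ↦ g.inner y (Y y) (X y)) = fun y ↦ g.inner y (X y) (Y y) :=
    funext fun y ↦ g.symm y _ _
  rw [leviCivita_apply, leviCivita_apply]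
  simp only [koszul, hs, VectorField.mlieBracket_swap_apply (V := Y) (W := X), map_neg,
    _root_.neg_apply] at h₁ h₂
  simp only [map_sub, _root_.sub_apply]
  linarith

/-- A vector field is a Killing field if `L_X g = 0`, i.e.
`X g(Y, Z) = g([X, Y], Z) + g(Y, [X, Z])` for all vector fields `Y`, `Z`. -/
def IsKillingField (X : Π x : M, TangentSpace I x) : Prop :=
  ∀ (x : M) (Y Z : Π x : M, TangentSpace I x), MDiffAt (T% Y) x → MDiffAt (T% Z) x →
    d% (fun y ↦ g.inner y (Y y) (Z y)) x (X x) =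
      g.inner x (VectorField.mlieBracket I X Y x) (Z x) +
        g.inner x (Y x) (VectorField.mlieBracket I X Z x)

end Riemannian

/-! ## Bivector fields -/

section Bivector

variable
  {E : Type*} [NormedAddCommGroup E] [NormedSpace ℝ E] [FiniteDimensional ℝ E]
  {H : Type*} [TopologicalSpace H] {I : ModelWithCorners ℝ E H}
  {M : Type*} [TopologicalSpace M] [ChartedSpace H M] [IsManifold I ∞ M]

open Classical in
/-- The covariant derivative `∇_v α` at `x` of a one-form `α`: the covector with
`(∇_v α)(Y) = v(α(Y)) - α(∇_v Y)` for all vector fields `Y` (this expression depends only on the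
value of `Y` at `x` if `α` is differentiable at `x`; otherwise the value is irrelevant). -/
noncomputable def covDerivOneForm (cov : CovariantDerivative I E (TangentSpace I : M → Type _))
    (α : Π x : M, TangentSpace I x →L[ℝ] ℝ) (x : M) (v : TangentSpace I x) :
    TangentSpace I x →L[ℝ] ℝ :=
  if h : TensorialAt I E (fun Y : Π x : M, TangentSpace I x ↦
      d% (fun y ↦ α y (Y y)) x v - α x (cov Y x v)) x then
    TensorialAt.mkHom _ x h
  else 0

/-- `(∇_v α)(Y) = v(α(Y)) - α(∇_v Y)` whenever `α` and `Y` are differentiable at `x`. -/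
theorem covDerivOneForm_apply (cov : CovariantDerivative I E (TangentSpace I : M → Type _))
    {α : Π x : M, TangentSpace I x →L[ℝ] ℝ} {x : M} (v : TangentSpace I x)
    (hα : ∀ Y : Π x : M, TangentSpace I x, MDiffAt (T% Y) x → MDiffAt (fun y ↦ α y (Y y)) x)
    {Y : Π x : M, TangentSpace I x} (hY : MDiffAt (T% Y) x) :
    covDerivOneForm cov α x v (Y x) = d% (fun y ↦ α y (Y y)) x v - α x (cov Y x v) := by
  have h : TensorialAt I E (fun Y : Π x : M, TangentSpace I x ↦
      d% (fun y ↦ α y (Y y)) x v - α x (cov Y x v)) x :=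
    { smul := by
        intro f Y hf hY
        simp [mvfderiv_fun_mul hf (hα Y hY), cov.isCovariantDerivativeOnUniv.leibniz hY hf]
        ring
      add := by
        intro Y Y' hY hY'
        simp [mvfderiv_fun_add (hα Y hY) (hα Y' hY'),
          cov.isCovariantDerivativeOnUniv.add hY hY']
        ring }
  simp only [covDerivOneForm, h, dite_true]
  exact TensorialAt.mkHom_apply h hY

/-- Extension of a covector at `x` to a one-form which is smooth near `x`. -/
noncomputable def extendCovector {x : M} (a : TangentSpace I x →L[ℝ] ℝ) :
    Π y : M, TangentSpace I y →L[ℝ] ℝ :=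
  FiberBundle.extend (E →L[ℝ] ℝ)
    (E := fun y : M ↦ TangentSpace I y →L[ℝ] Bundle.Trivial M ℝ y) a

theorem extendCovector_self {x : M} (a : TangentSpace I x →L[ℝ] ℝ) : extendCovector a x = a :=
  FiberBundle.extend_apply_self (E →L[ℝ] ℝ)
    (E := fun y : M ↦ TangentSpace I y →L[ℝ] Bundle.Trivial M ℝ y) a

/-- The extensions used below are differentiable one-forms, so that `covDerivOneForm_apply`
applies to them. -/
theorem mdifferentiableAt_extendCovector {x : M} (a : TangentSpace I x →L[ℝ] ℝ)
    {Y : Π x : M, TangentSpace I x} (hY : MDiffAt (T% Y) x) :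
    MDiffAt (fun y ↦ extendCovector a y (Y y)) x := by
  have ha := FiberBundle.mdifferentiableAt_extend I (E →L[ℝ] ℝ)
    (V := fun y : M ↦ TangentSpace I y →L[ℝ] Bundle.Trivial M ℝ y) a
  have h := MDifferentiableAt.clm_bundle_apply (E₂ := Bundle.Trivial M ℝ) ha hY
  simp only [mdifferentiableAt_totalSpace] at h
  exact h.2

/-- The covariant derivative of a bivector field `P`:
`(∇_v P)(a, b) = v(P(α, β)) - P(∇_v α, β) - P(α, ∇_v β)`, where `α`, `β` are one-forms extending
the covectors `a`, `b`. -/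
noncomputable def covDerivBivector (cov : CovariantDerivative I E (TangentSpace I : M → Type _))
    (P : Π x : M, ⋀[ℝ]^2 (TangentSpace I x)) (x : M) (v : TangentSpace I x)
    (a b : TangentSpace I x →L[ℝ] ℝ) : ℝ :=
  d% (fun y ↦ pair (P y) (extendCovector a y) (extendCovector b y)) x v
    - pair (P x) (covDerivOneForm cov (extendCovector a) x v) b
    - pair (P x) a (covDerivOneForm cov (extendCovector b) x v)

/-- The divergence of a bivector field with respect to a connection: the contraction
`(div P)(b) = ∑ i, (∇_{e i} P)(e^i, b)`, where `e` is a basis of the tangent space at `x` and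
`e^i` the dual basis; it is given as a function on covectors. -/
noncomputable def divergence (cov : CovariantDerivative I E (TangentSpace I : M → Type _))
    (P : Π x : M, ⋀[ℝ]^2 (TangentSpace I x)) (x : M) (b : TangentSpace I x →L[ℝ] ℝ) : ℝ :=
  have : T2Space (TangentSpace I x) := inferInstanceAs (T2Space E)
  ∑ i, covDerivBivector cov P x (Module.finBasis ℝ (TangentSpace I x) i)
    (LinearMap.toContinuousLinearMap ((Module.finBasis ℝ (TangentSpace I x)).coord i)) b

/-- The bracket `{f, h} = P(df, dh)`. -/
noncomputable def bracket (P : Π x : M, ⋀[ℝ]^2 (TangentSpace I x)) (f h : M → ℝ) (x : M) : ℝ :=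
  pair (P x) (d% f x : TangentSpace I x →L[ℝ] ℝ) (d% h x : TangentSpace I x →L[ℝ] ℝ)

/-- The hamiltonian vector field `H_f` of `f`, determined by `dh(H_f) = {f, h}`. -/
noncomputable def hamiltonian (P : Π x : M, ⋀[ℝ]^2 (TangentSpace I x)) (f : M → ℝ) (x : M) :
    TangentSpace I x :=
  - sharp (P x) (d% f x : TangentSpace I x →L[ℝ] ℝ)

theorem mvfderiv_hamiltonian (P : Π x : M, ⋀[ℝ]^2 (TangentSpace I x)) (f h : M → ℝ) (x : M) :
    d% h x (hamiltonian P f x) = bracket P f h x := by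
  rw [bracket, pair_swap]
  simp [hamiltonian, pair]

/-- The Lie derivative of a bivector field, evaluated on the differentials of two functions:
`(L_X P)(df, dh) = X(P(df, dh)) - P(d(X f), dh) - P(df, d(X h))`. -/
noncomputable def lieDerivBivector (X : Π x : M, TangentSpace I x)
    (P : Π x : M, ⋀[ℝ]^2 (TangentSpace I x)) (f h : M → ℝ) (x : M) : ℝ :=
  d% (bracket P f h) x (X x) - bracket P (fun y ↦ d% f y (X y)) h x
    - bracket P f (fun y ↦ d% h y (X y)) x

/-- A bivector field is a Poisson tensor if it is smooth and `{f, h} = P(df, dh)` satisfies the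
Jacobi identity on smooth functions (it is bilinear, skew-symmetric and a derivation in each
argument in any case). Smoothness is expressed through the functions `P(df, dh)`, for `f`, `h`
smooth on an open set; for coordinate functions these are the components of `P`. -/
structure IsPoissonTensor (P : Π x : M, ⋀[ℝ]^2 (TangentSpace I x)) : Prop where
  smooth : ∀ U : Set M, IsOpen U → ∀ f h : M → ℝ,
    ContMDiffOn I 𝓘(ℝ, ℝ) ∞ f U → ContMDiffOn I 𝓘(ℝ, ℝ) ∞ h U →
      ContMDiffOn I 𝓘(ℝ, ℝ) ∞ (bracket P f h) U
  jacobi : ∀ f h k : M → ℝ,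
    ContMDiff I 𝓘(ℝ, ℝ) ∞ f → ContMDiff I 𝓘(ℝ, ℝ) ∞ h → ContMDiff I 𝓘(ℝ, ℝ) ∞ k → ∀ x : M,
      bracket P f (bracket P h k) x + bracket P h (bracket P k f) x
        + bracket P k (bracket P f h) x = 0

/-- A Killing-Poisson tensor on a Riemannian manifold: a Poisson tensor whose divergence with
respect to the Levi-Civita connection vanishes, and such that `L_{∇f} P = 0` on every open set
`U` for every Casimir function `f` on `U`. -/
structure IsKillingPoisson (g : ContMDiffRiemannianMetric I ∞ E (fun x : M ↦ TangentSpace I x))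
    (P : Π x : M, ⋀[ℝ]^2 (TangentSpace I x)) : Prop where
  poisson : IsPoissonTensor P
  divergence_eq_zero : ∀ (x : M) (b : TangentSpace I x →L[ℝ] ℝ),
    divergence (leviCivita g) P x b = 0
  lieDeriv_gradient_casimir : ∀ U : Set M, IsOpen U → ∀ f : M → ℝ,
    ContMDiffOn I 𝓘(ℝ, ℝ) ∞ f U → (∀ x ∈ U, hamiltonian P f x = 0) →
      ∀ h k : M → ℝ, ContMDiffOn I 𝓘(ℝ, ℝ) ∞ h U → ContMDiffOn I 𝓘(ℝ, ℝ) ∞ k U →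
        ∀ x ∈ U, lieDerivBivector (gradient g f) P h k x = 0

end Bivector

/-! ## Infinitesimal actions -/

section Action

variable
  {E : Type*} [NormedAddCommGroup E] [NormedSpace ℝ E]
  {H : Type*} [TopologicalSpace H] (I : ModelWithCorners ℝ E H)
  (M : Type*) [TopologicalSpace M] [ChartedSpace H M] [IsManifold I ∞ M]
  (L : Type*) [LieRing L] [LieAlgebra ℝ L]

/-- An action of a Lie algebra `L` on `M`: a morphism of Lie algebras from `L` to the smooth
vector fields on `M`. -/
structure LieAlgebraAction where
  toFun : L →ₗ[ℝ] ContMDiffSection I E ∞ (TangentSpace I : M → Type _)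
  map_lie : ∀ (u v : L) (x : M),
    toFun ⁅u, v⁆ x = VectorField.mlieBracket I (fun y ↦ toFun u y) (fun y ↦ toFun v y) x

variable {I M L}

/-- The linear map `L → T_x M`, `u ↦ Γ(u)(x)`. -/
noncomputable def LieAlgebraAction.evalAt (Γ : LieAlgebraAction I M L) (x : M) :
    L →ₗ[ℝ] TangentSpace I x where
  toFun u := Γ.toFun u x
  map_add' u v := by simp
  map_smul' c u := by simp

/-- An action is locally free if all its stabilizers `{u | Γ(u)(x) = 0}` are trivial. -/
def LieAlgebraAction.IsLocallyFree (Γ : LieAlgebraAction I M L) : Prop :=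
  ∀ x : M, Function.Injective (Γ.evalAt x)

/-- The bivector field `Γ(r)`, with `Γ(u ∧ v) = Γ(u) ∧ Γ(v)`. -/
noncomputable def LieAlgebraAction.inducedBivector (Γ : LieAlgebraAction I M L) (r : ⋀[ℝ]^2 L)
    (x : M) : ⋀[ℝ]^2 (TangentSpace I x) :=
  exteriorPower.map 2 (Γ.evalAt x) r

end Action

end KillingPoisson

namespace KillingPoisson

section VectorFields

open VectorField Set Filter Topology

variable
  {E : Type*} [NormedAddCommGroup E] [NormedSpace ℝ E]
  {H : Type*} [TopologicalSpace H] {I : ModelWithCorners ℝ E H}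
  {M : Type*} [TopologicalSpace M] [ChartedSpace H M]

theorem mvfderiv_congr {f h : M → ℝ} {x : M} (hfh : f =ᶠ[𝓝 x] h) : d% f x = d% h x := by
  ext v
  exact congrArg (fun A : E →L[ℝ] ℝ ↦ A v) hfh.mfderiv_eq

theorem mdifferentiableAt_fun_sum {ι F : Type*} [NormedAddCommGroup F] [NormedSpace ℝ F]
    {s : Finset ι} {f : ι → M → F} {x : M} (hf : ∀ i ∈ s, MDiffAt (f i) x) :
    MDiffAt (fun y ↦ ∑ i ∈ s, f i y) x := by
  classical
  induction s using Finset.induction_on with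
  | empty => simpa using mdifferentiableAt_const
  | insert a s ha ih =>
    simp only [Finset.sum_insert ha]
    exact (hf a (Finset.mem_insert_self a s)).add
      (ih fun i hi ↦ hf i (Finset.mem_insert_of_mem hi))

theorem mvfderiv_fun_sum {ι : Type*} {s : Finset ι} {f : ι → M → ℝ} {x : M}
    (hf : ∀ i ∈ s, MDiffAt (f i) x) :
    d% (fun y ↦ ∑ i ∈ s, f i y) x = ∑ i ∈ s, d% (f i) x := by
  classical
  induction s using Finset.induction_on with
  | empty => simpa using mvfderiv_const (0 : ℝ)
  | insert a s ha ih =>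
    have h := fun i hi ↦ hf i (Finset.mem_insert_of_mem hi)
    simp only [Finset.sum_insert ha]
    rw [mvfderiv_fun_add (hf a (Finset.mem_insert_self a s)) (mdifferentiableAt_fun_sum h), ih h]

theorem mvfderiv_eq_fderivWithin_extChartAt {G : M → ℝ} {x : M} (hG : MDiffAt G x) (v : E) :
    d% G x (v : TangentSpace I x) =
      fderivWithin ℝ (G ∘ (extChartAt I x).symm) (range I) (extChartAt I x x) v := by
  simp only [mvfderiv, mfderiv, hG]
  rfl

variable [IsManifold I ∞ M]

theorem exists_mdifferentiableAt_eq {x : M} (v : TangentSpace I x) :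
    ∃ X : Π x : M, TangentSpace I x, MDiffAt (T% X) x ∧ X x = v :=
  ⟨FiberBundle.extend E v, FiberBundle.mdifferentiableAt_extend I E _, by simp⟩

/-- The derivative of a smooth function along a smooth vector field is smooth. -/
theorem contMDiffAt_mvfderiv_apply {f : M → ℝ} {X : Π x : M, TangentSpace I x} {x : M}
    (hf : ContMDiffAt I 𝓘(ℝ, ℝ) ∞ f x) (hX : ContMDiffAt I I.tangent ∞ (T% X) x) :
    ContMDiffAt I 𝓘(ℝ, ℝ) ∞ (fun y ↦ d% f y (X y)) x := by
  have h := ContMDiffAt.clm_apply_of_inCoordinates (b₁ := id) (b₂ := f)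
    (ϕ := fun y ↦ mfderiv I 𝓘(ℝ, ℝ) f y)
    (hf.mfderiv_const (m := ∞) le_rfl) hX hf
  exact (contMDiff_snd_tangentBundle_modelSpace ℝ 𝓘(ℝ, ℝ)).contMDiffAt.comp x h

/-- The derivative of a smooth function along a differentiable vector field is differentiable. -/
theorem mdifferentiableAt_mvfderiv_apply {f : M → ℝ} {X : Π x : M, TangentSpace I x} {x : M}
    (hf : ContMDiffAt I 𝓘(ℝ, ℝ) ∞ f x) (hX : MDiffAt (T% X) x) :
    MDiffAt (fun y ↦ d% f y (X y)) x := by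
  have h := MDifferentiableAt.clm_apply_of_inCoordinates (b₁ := id) (b₂ := f)
    (ϕ := fun y ↦ mfderiv I 𝓘(ℝ, ℝ) f y)
    ((hf.mfderiv_const (m := ∞) le_rfl).mdifferentiableAt (by simp)) hX
    (hf.mdifferentiableAt (by simp))
  exact ((contMDiff_snd_tangentBundle_modelSpace ℝ 𝓘(ℝ, ℝ)).mdifferentiable
    (n := 1) one_ne_zero).mdifferentiableAt.comp x h

theorem mvfderiv_apply_comp_extChartAt_symm {f : M → ℝ} {x : M}
    (hf : ContMDiffAt I 𝓘(ℝ, ℝ) ∞ f x) (W : Π x : M, TangentSpace I x) :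
    (fun p ↦ d% f p (W p)) ∘ (extChartAt I x).symm =ᶠ[𝓝[range I] (extChartAt I x x)]
      fun y ↦ fderivWithin ℝ (f ∘ (extChartAt I x).symm) (range I) y
        (mpullbackWithin 𝓘(ℝ, E) I (extChartAt I x).symm W (range I) y) := by
  have hf' : ∀ᶠ p in 𝓝 x, MDiffAt f p := by
    have : IsManifold I 1 M := IsManifold.of_le (n := ∞) (by norm_cast)
    have hf₁ : ContMDiffAt I 𝓘(ℝ, ℝ) 1 f x := hf.of_le (by norm_cast)
    filter_upwards [(contMDiffAt_iff_contMDiffAt_nhds (by simp)).1 hf₁] with p hp using hp.mdifferentiableAt one_ne_zero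
  have hc : Tendsto (extChartAt I x).symm (𝓝[range I] (extChartAt I x x)) (𝓝 x) := by
    have := (continuousAt_extChartAt_symm (I := I) x).tendsto
    rw [extChartAt_to_inv] at this
    exact this.mono_left nhdsWithin_le_nhds
  filter_upwards [hc.eventually hf', extChartAt_target_mem_nhdsWithin (I := I) x] with y hy hyt
  have hyr : y ∈ range I := extChartAt_target_subset_range x hyt
  have hu : UniqueMDiffWithinAt 𝓘(ℝ, E) (range I) y :=
    (I.uniqueDiffOn y hyr).uniqueMDiffWithinAt
  have h := mfderiv_comp_mfderivWithin (I := 𝓘(ℝ, E)) (I' := I) (I'' := 𝓘(ℝ, ℝ)) y hy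
    (mdifferentiableWithinAt_extChartAt_symm hyt) hu
  rw [mfderivWithin_eq_fderivWithin] at h
  rw [h]
  have hinv := (isInvertible_mfderivWithin_extChartAt_symm (I := I) hyt).self_comp_inverse
  have := congrArg (fun A ↦ A (W ((extChartAt I x).symm y))) hinv
  simp only [mpullbackWithin_apply]
  change _ = mfderiv I 𝓘(ℝ, ℝ) f ((extChartAt I x).symm y)
    (((mfderivWithin 𝓘(ℝ, E) I (extChartAt I x).symm (range I) y).comp
      (mfderivWithin 𝓘(ℝ, E) I (extChartAt I x).symm (range I) y).inverse)
        (W ((extChartAt I x).symm y)))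
  rw [hinv]
  rfl

/-- The Lie bracket of vector fields acts on functions as the commutator. -/
theorem mvfderiv_mlieBracket [CompleteSpace E] {f : M → ℝ} {V W : Π x : M, TangentSpace I x}
    {x : M} (hf : ContMDiffAt I 𝓘(ℝ, ℝ) ∞ f x) (hV : MDiffAt (T% V) x) (hW : MDiffAt (T% W) x) :
    d% f x (mlieBracket I V W x) =
      d% (fun y ↦ d% f y (W y)) x (V x) - d% (fun y ↦ d% f y (V y)) x (W x) := by
  have : IsManifold I 2 M := IsManifold.of_le (n := ∞) (by norm_cast)
  have hx' : extChartAt I x x ∈ range I := mem_range_self _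
  have hV' := (hV.mdifferentiableWithinAt (s := univ)
    ).differentiableWithinAt_mpullbackWithin_vectorField
  have hW' := (hW.mdifferentiableWithinAt (s := univ)
    ).differentiableWithinAt_mpullbackWithin_vectorField
  simp only [preimage_univ, univ_inter] at hV' hW'
  have hF : ContDiffWithinAt ℝ 2 (f ∘ (extChartAt I x).symm) (range I) (extChartAt I x x) :=
    ((contMDiffAt_iff.1 hf).2).of_le (by norm_cast)
  have key := fderivWithin_apply_lieBracket hF (by simp) I.uniqueDiffOn
    (I.range_subset_closure_interior hx') hx' hW' hV'
  have hself (X : Π x : M, TangentSpace I x) :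
      mpullbackWithin 𝓘(ℝ, E) I (extChartAt I x).symm X (range I) (extChartAt I x x) = X x := by
    rw [mpullbackWithin_apply]
    have hp : ∀ p : M, p = x → (X p : E) = X x := by rintro _ rfl; rfl
    refine Eq.trans ?_ (mfderivWithin_extChartAt_symm_inverse_apply (X x))
    exact congrArg (mfderivWithin 𝓘(ℝ, E) I (extChartAt I x).symm (range I)
      (extChartAt I x x)).inverse (hp _ (extChartAt_to_inv x))
  have hbr : mlieBracket I V W x = lieBracketWithin ℝ
      (mpullbackWithin 𝓘(ℝ, E) I (extChartAt I x).symm V (range I))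
      (mpullbackWithin 𝓘(ℝ, E) I (extChartAt I x).symm W (range I)) (range I)
      (extChartAt I x x) := by
    rw [← mlieBracketWithin_univ, mlieBracketWithin_apply, mfderiv_extChartAt_self]
    change (ContinuousLinearMap.id ℝ E).inverse _ = _
    rw [ContinuousLinearMap.inverse_id, preimage_univ, univ_inter]
    rfl
  have hder (X Y : Π x : M, TangentSpace I x) (hX : MDiffAt (T% X) x) :
      d% (fun y ↦ d% f y (X y)) x (Y x) =
        fderivWithin ℝ (fun y ↦ fderivWithin ℝ (f ∘ (extChartAt I x).symm) (range I) y
          (mpullbackWithin 𝓘(ℝ, E) I (extChartAt I x).symm X (range I) y)) (range I)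
          (extChartAt I x x)
          (mpullbackWithin 𝓘(ℝ, E) I (extChartAt I x).symm Y (range I) (extChartAt I x x)) := by
    rw [hself Y]
    refine (mvfderiv_eq_fderivWithin_extChartAt (mdifferentiableAt_mvfderiv_apply hf hX) _).trans ?_
    rw [(mvfderiv_apply_comp_extChartAt_symm hf X).fderivWithin_eq_of_mem hx']
  rw [hder W V hW, hder V W hV, hbr]
  exact (mvfderiv_eq_fderivWithin_extChartAt (hf.mdifferentiableAt (by simp)) _).trans key

end VectorFields

section BivectorAlgebra

variable {V W : Type*} [AddCommGroup V] [Module ℝ V] [AddCommGroup W] [Module ℝ W]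

theorem sharp_map (φ : V →ₗ[ℝ] W) (r : ⋀[ℝ]^2 V) (β : Module.Dual ℝ W) :
    sharp (exteriorPower.map 2 φ r) β = φ (sharp r (β ∘ₗ φ)) := by
  have hr : r ∈ Submodule.span ℝ (Set.range (exteriorPower.ιMulti ℝ 2 (M := V))) := by
    rw [exteriorPower.ιMulti_span]; trivial
  induction hr using Submodule.span_induction with
  | mem x h =>
    obtain ⟨w, rfl⟩ := h
    simp [sharp]
  | zero => simp
  | add x y _ _ hx hy => simp only [map_add, LinearMap.add_apply, hx, hy]
  | smul c x _ hx => simp only [map_smul, LinearMap.smul_apply, hx]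

theorem finiteDimensional_range_sharp (r : ⋀[ℝ]^2 V) :
    FiniteDimensional ℝ (LinearMap.range (sharp r)) := by
  suffices h : ∃ S : Submodule ℝ V, FiniteDimensional ℝ S ∧ ∀ β, sharp r β ∈ S by
    obtain ⟨S, hS, h⟩ := h
    refine Submodule.finiteDimensional_of_le (S₂ := S) ?_
    rintro _ ⟨β, rfl⟩
    exact h β
  have hr : r ∈ Submodule.span ℝ (Set.range (exteriorPower.ιMulti ℝ 2 (M := V))) := by
    rw [exteriorPower.ιMulti_span]; trivial
  induction hr using Submodule.span_induction with
  | mem x h =>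
    obtain ⟨w, rfl⟩ := h
    refine ⟨Submodule.span ℝ (Set.range w), FiniteDimensional.span_of_finite ℝ (Set.finite_range w), fun β ↦ ?_⟩
    simp only [sharp, exteriorPower.alternatingMapLinearEquiv_apply_ιMulti]
    exact Submodule.sub_mem _
      (Submodule.smul_mem _ _ (Submodule.subset_span (Set.mem_range_self _)))
      (Submodule.smul_mem _ _ (Submodule.subset_span (Set.mem_range_self _)))
  | zero => exact ⟨⊥, inferInstance, fun β ↦ by simp⟩
  | add x y _ _ hx hy =>
    obtain ⟨S, hS, h⟩ := hx
    obtain ⟨T, hT, h'⟩ := hy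
    exact ⟨S ⊔ T, inferInstance, fun β ↦ by
      simpa using Submodule.add_mem_sup (h β) (h' β)⟩
  | smul c x _ hx =>
    obtain ⟨S, hS, h⟩ := hx
    exact ⟨S, hS, fun β ↦ by simpa using S.smul_mem c (h β)⟩

end BivectorAlgebra

section UnimodularAlgebra

variable {L : Type*} [LieRing L] [LieAlgebra ℝ L]

/-- A unimodular solution `r` of the Yang-Baxter equation is a finite sum `∑ j, w j ⊗ u j` with
`w j`, `u j` in its image and `∑ j, [w j, u j] = 0`. -/
theorem IsYangBaxter.exists_expansion {r : ⋀[ℝ]^2 L} (hr : IsYangBaxter r)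
    (hu : IsUnimodularLieAlgebra (imageSubalgebra r hr)) :
    ∃ (n : ℕ) (w u : Fin n → L),
      (∀ j, w j ∈ LinearMap.range (sharp r)) ∧ (∀ j, u j ∈ LinearMap.range (sharp r)) ∧
      (∀ β, sharp r β = ∑ j, β (u j) • w j) ∧ ∑ j, ⁅w j, u j⁆ = 0 ∧
      ∀ B : L →ₗ[ℝ] L →ₗ[ℝ] ℝ, ∑ j, B (w j) (u j) = -∑ j, B (u j) (w j) := by
  let K : LieSubalgebra ℝ L := imageSubalgebra r hr
  have hKmem (β : Module.Dual ℝ L) : sharp r β ∈ K := ⟨β, rfl⟩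
  have : FiniteDimensional ℝ K := finiteDimensional_range_sharp r
  let s := Module.finBasis ℝ K
  have hext (j) : ∃ ξ : Module.Dual ℝ L, ξ ∘ₗ K.toSubmodule.subtype = s.coord j :=
    LinearMap.exists_extend _
  choose ξ hξ using hext
  have hξ' (j) (v : L) (hv : v ∈ K) : ξ j v = s.repr ⟨v, hv⟩ j :=
    congrArg (fun φ ↦ φ (⟨v, hv⟩ : K)) (hξ j)
  have hsum (v : L) (hv : v ∈ K) : v = ∑ j, ξ j v • (s j : L) := by
    have h := congrArg (K.toSubmodule.subtype) (s.sum_repr ⟨v, hv⟩)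
    rw [map_sum] at h
    refine h.symm.trans (Finset.sum_congr rfl fun j _ ↦ ?_)
    rw [hξ' j v hv, map_smul]
    rfl
  have hanti (α β : Module.Dual ℝ L) : α (sharp r β) = -β (sharp r α) := pair_swap r α β
  have hsharp (β : Module.Dual ℝ L) : sharp r β = ∑ j, β (s j) • sharp r (ξ j) := by
    rw [← sub_eq_zero, ← Module.forall_dual_apply_eq_zero_iff ℝ]
    intro α
    have h := congrArg β (hsum _ (hKmem α))
    rw [map_sub, map_sum, hanti, h, map_sum]
    simp only [map_smul, smul_eq_mul, hanti α]
    rw [← Finset.sum_neg_distrib, ← Finset.sum_sub_distrib]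
    exact Finset.sum_eq_zero fun j _ ↦ by ring
  have htr (γ : Module.Dual ℝ L) : ∑ j, ξ j ⁅sharp r γ, (s j : L)⁆ = 0 := by
    have h := hu ⟨sharp r γ, hKmem γ⟩
    rw [LinearMap.trace_eq_matrix_trace ℝ s, Matrix.trace] at h
    rw [← h]
    refine Finset.sum_congr rfl fun j _ ↦ ?_
    rw [Matrix.diag_apply, LinearMap.toMatrix_apply, hξ' j _ (K.lie_mem (hKmem γ) (s j).2)]
    rfl
  refine ⟨_, fun j ↦ sharp r (ξ j), fun j ↦ s j, fun j ↦ ⟨_, rfl⟩, fun j ↦ (s j).2, hsharp,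
    ?_, ?_⟩
  · rw [← Module.forall_dual_apply_eq_zero_iff ℝ]
    intro γ
    have hη (j) : ∃ η : Module.Dual ℝ L, sharp r η = s j := (s j).2
    choose η hη using hη
    have h₁ (j) := hr (ξ j) (η j) γ
    simp only [hη] at h₁
    have h₂ : ∑ j, η j ⁅sharp r γ, sharp r (ξ j)⁆ = -∑ j, ξ j ⁅sharp r γ, (s j : L)⁆ := by
      have hcoef (j) : η j ⁅sharp r γ, sharp r (ξ j)⁆ =
          ∑ i, ξ i ⁅sharp r γ, sharp r (ξ j)⁆ * η j (s i) := by
        conv_lhs => rw [hsum _ (K.lie_mem (hKmem γ) (hKmem (ξ j)))]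
        simp
      have hsi (i) : ξ i ⁅sharp r γ, (s i : L)⁆ =
          ∑ j, ξ i ⁅sharp r γ, sharp r (ξ j)⁆ * -η j (s i) := by
        have hs : (s i : L) = ∑ j, (-η j (s i)) • sharp r (ξ j) := by
          refine (hη i).symm.trans ((hsharp (η i)).trans (Finset.sum_congr rfl fun j _ ↦ ?_))
          have h := hanti (η i) (η j)
          rw [hη, hη] at h
          rw [h]
        conv_lhs => rw [hs]
        simp [lie_sum, mul_comm]
      simp only [hcoef, hsi]
      rw [Finset.sum_comm]
      simp
    have h₃ : ∑ j, ξ j ⁅(s j : L), sharp r γ⁆ = 0 := by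
      rw [← neg_eq_zero, ← htr γ, ← Finset.sum_neg_distrib]
      refine Finset.sum_congr rfl fun j _ ↦ ?_
      rw [← map_neg, lie_skew]
    have h := Finset.sum_congr rfl fun j (_ : j ∈ Finset.univ) ↦ h₁ j
    rw [Finset.sum_add_distrib, Finset.sum_add_distrib, h₂, h₃, htr γ] at h
    simpa using h
  · intro B
    have hw (j) : sharp r (ξ j) = ∑ i, ξ i (sharp r (ξ j)) • (s i : L) := hsum _ (hKmem _)
    have h₁ (j) : B (sharp r (ξ j)) (s j) = ∑ i, ξ i (sharp r (ξ j)) * B (s i) (s j) := by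
      conv_lhs => rw [hw j]
      simp
    have h₂ (j) : B (s j) (sharp r (ξ j)) = ∑ i, ξ i (sharp r (ξ j)) * B (s j) (s i) := by
      conv_lhs => rw [hw j]
      simp
    simp only [h₁, h₂]
    rw [Finset.sum_comm, ← Finset.sum_neg_distrib]
    refine Finset.sum_congr rfl fun i _ ↦ ?_
    rw [← Finset.sum_neg_distrib]
    refine Finset.sum_congr rfl fun j _ ↦ ?_
    rw [hanti (ξ i)]
    ring

end UnimodularAlgebra

section KillingFields

open VectorField Set Filter Topology

variable
  {E : Type*} [NormedAddCommGroup E] [NormedSpace ℝ E] [FiniteDimensional ℝ E]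
  {H : Type*} [TopologicalSpace H] {I : ModelWithCorners ℝ E H}
  {M : Type*} [TopologicalSpace M] [ChartedSpace H M] [IsManifold I ∞ M]
  (g : ContMDiffRiemannianMetric I ∞ E (fun x : M ↦ TangentSpace I x))

theorem inner_gradient (f : M → ℝ) (x : M) (w : TangentSpace I x) :
    g.inner x (gradient g f x) w = d% f x w :=
  inner_flat_symm g x _ w

theorem isInvertible_of_apply_self_ne_zero {V : Type*} [NormedAddCommGroup V] [NormedSpace ℝ V]
    [FiniteDimensional ℝ V] (G : V →L[ℝ] V →L[ℝ] ℝ) (hG : ∀ v, v ≠ 0 → G v v ≠ 0) :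
    G.IsInvertible := by
  have hinj : Function.Injective G := by
    rw [injective_iff_map_eq_zero]
    intro v hv
    by_contra hne
    exact hG v hne (by rw [hv]; rfl)
  have hdim : Module.finrank ℝ V = Module.finrank ℝ (V →L[ℝ] ℝ) := by
    rw [← (LinearMap.toContinuousLinearMap (𝕜 := ℝ) (E := V) (F' := ℝ)).finrank_eq]
    exact Subspace.dual_finrank_eq.symm
  exact ⟨(LinearMap.linearEquivOfInjective G.toLinearMap hinj hdim).toContinuousLinearEquiv,
    by ext; rfl⟩

/-- The gradient of a smooth function is differentiable. -/
theorem mdifferentiableAt_gradient {f : M → ℝ} {x : M} (hf : ContMDiffAt I 𝓘(ℝ, ℝ) ∞ f x) :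
    MDiffAt (T% (gradient g f)) x := by
  let e := trivializationAt E (TangentSpace I : M → Type _) x
  have hxe : x ∈ e.baseSet := FiberBundle.mem_baseSet_trivializationAt' x
  let b := Module.finBasis ℝ E
  let c (i) : E →L[ℝ] ℝ := LinearMap.toContinuousLinearMap (b.coord i)
  let S (i) : Π y : M, TangentSpace I y := fun y ↦ e.symmL ℝ y (b i)
  have hS (i) : MDiffAt (T% (S i)) x := by
    rw [mdifferentiableAt_section]
    refine (mdifferentiableAt_const (c := b i)).congr_of_eventuallyEq ?_
    filter_upwards [e.open_baseSet.mem_nhds hxe] with y hy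
    have := e.continuousLinearMapAt_symmL (R := ℝ) hy (b i)
    rwa [e.continuousLinearMapAt_apply ℝ, e.coe_linearMapAt_of_mem hy] at this
  let G (y : M) : E →L[ℝ] E →L[ℝ] ℝ :=
    ∑ i, ∑ j, g.inner y (S i y) (S j y) • (c i).smulRight (c j)
  let φ (y : M) : E →L[ℝ] ℝ := ∑ j, d% f y (S j y) • c j
  have hexp (y : M) (v : E) : e.symmL ℝ y v = ∑ i, c i v • S i y := by
    conv_lhs => rw [← b.sum_repr v]
    rw [map_sum]
    simp [S, c]
  have hGapp (y : M) (v w : E) : G y v w = g.inner y (e.symmL ℝ y v) (e.symmL ℝ y w) := by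
    simp only [hexp, map_sum, G, _root_.sum_apply, map_smul]
    simp [Finset.mul_sum]
    rw [Finset.sum_comm]
    refine Finset.sum_congr rfl fun i _ ↦ Finset.sum_congr rfl fun j _ ↦ ?_
    ring
  have hφapp (y : M) (w : E) : φ y w = d% f y (e.symmL ℝ y w) := by
    simp only [hexp, map_sum, φ, _root_.sum_apply, map_smul]
    simp [mul_comm]
  have hGinv (y : M) (hy : y ∈ e.baseSet) : (G y).IsInvertible := by
    refine isInvertible_of_apply_self_ne_zero _ fun v hv h ↦ ?_
    rw [hGapp] at h
    refine (g.pos y (e.symmL ℝ y v) fun h0 ↦ hv ?_).ne' h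
    rw [← e.continuousLinearMapAt_symmL (R := ℝ) hy v, h0, map_zero]
  have hG : MDiffAt G x := by
    simp only [G]
    refine mdifferentiableAt_fun_sum fun i _ ↦ mdifferentiableAt_fun_sum fun j _ ↦ ?_
    exact (mdifferentiableAt_inner g (hS i) (hS j)).smul mdifferentiableAt_const
  have hφ : MDiffAt φ x :=
    mdifferentiableAt_fun_sum fun j _ ↦
      (mdifferentiableAt_mvfderiv_apply hf (hS j)).smul mdifferentiableAt_const
  have hinv : MDiffAt (fun y ↦ (G y).inverse (φ y)) x := by
    have h := (((hGinv x hxe).contDiffAt_map_inverse (n := 1)).differentiableAt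
      one_ne_zero).mdifferentiableAt.comp x hG
    exact MDifferentiableAt.clm_apply h hφ
  rw [mdifferentiableAt_section]
  refine hinv.congr_of_eventuallyEq ?_
  filter_upwards [e.open_baseSet.mem_nhds hxe] with y hy
  have hv : (e ⟨y, gradient g f y⟩).2 = e.continuousLinearMapAt ℝ y (gradient g f y) := by
    rw [e.continuousLinearMapAt_apply ℝ, e.coe_linearMapAt_of_mem hy]
  refine hv.trans ?_
  rw [eq_comm, (hGinv y hy).inverse_apply_eq]
  ext w
  rw [hGapp, hφapp, e.symmL_continuousLinearMapAt hy, inner_gradient]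

variable {g}

/-- The covariant derivative of a Killing field is skew-symmetric. -/
theorem IsKillingField.inner_leviCivita_add {X : Π x : M, TangentSpace I x}
    (hK : IsKillingField g X) {x : M} (hX : MDiffAt (T% X) x) (v w : TangentSpace I x) :
    g.inner x (leviCivita g X x v) w + g.inner x v (leviCivita g X x w) = 0 := by
  obtain ⟨Y, hY, rfl⟩ := exists_mdifferentiableAt_eq v
  obtain ⟨Z, hZ, rfl⟩ := exists_mdifferentiableAt_eq w
  have h₁ := hK x Y Z hY hZ
  have h₂ := leviCivita_metric g (X x) hY hZ
  rw [← leviCivita_torsionFree g hX hY, ← leviCivita_torsionFree g hX hZ] at h₁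
  simp only [map_sub, _root_.sub_apply] at h₁
  linarith

theorem trace_eq_zero_of_skew {V : Type*} [AddCommGroup V] [Module ℝ V] [FiniteDimensional ℝ V]
    (e : V ≃ₗ[ℝ] Module.Dual ℝ V) (A : V →ₗ[ℝ] V) (hA : ∀ v w, e (A v) w + e v (A w) = 0) :
    LinearMap.trace ℝ V A = 0 := by
  have h : e.conj A + Module.Dual.transpose (R := ℝ) A = 0 := by
    ext φ w
    obtain ⟨v, rfl⟩ := e.surjective φ
    simp only [LinearMap.add_apply, LinearEquiv.conj_apply_apply, LinearEquiv.symm_apply_apply,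
      Module.Dual.transpose_apply, LinearMap.comp_apply]
    exact hA v w
  have h' := congrArg (LinearMap.trace ℝ (Module.Dual ℝ V)) h
  rw [map_add, LinearMap.trace_conj', LinearMap.trace_transpose', map_zero] at h'
  linarith

/-- Killing fields are divergence free. -/
theorem IsKillingField.trace_leviCivita {X : Π x : M, TangentSpace I x}
    (hK : IsKillingField g X) {x : M} (hX : MDiffAt (T% X) x) :
    LinearMap.trace ℝ (TangentSpace I x) (leviCivita g X x).toLinearMap = 0 :=
  trace_eq_zero_of_skew (flat g x) _ fun v w ↦ hK.inner_leviCivita_add hX v w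

/-- A Killing field commutes with the gradient of a function which it preserves. -/
theorem IsKillingField.mlieBracket_gradient {X : Π x : M, TangentSpace I x}
    (hK : IsKillingField g X) {x : M} (hX : MDiffAt (T% X) x) {f : M → ℝ}
    (hf : ContMDiffAt I 𝓘(ℝ, ℝ) ∞ f x) (hXf : ∀ᶠ y in 𝓝 x, d% f y (X y) = 0) :
    mlieBracket I X (gradient g f) x = 0 := by
  have := FiniteDimensional.complete ℝ E
  refine eq_of_inner_eq g fun Z hZ ↦ ?_
  have h := hK x (gradient g f) Z (mdifferentiableAt_gradient g hf) hZ
  simp only [inner_gradient, mvfderiv_mlieBracket hf hX hZ] at h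
  have h₀ : d% (fun y ↦ d% f y (X y)) x (Z x) = 0 := by
    have : (fun y ↦ d% f y (X y)) =ᶠ[𝓝 x] fun _ ↦ (0 : ℝ) := hXf
    rw [mvfderiv_congr this, mvfderiv_const]
    rfl
  rw [h₀] at h
  rw [map_zero, _root_.zero_apply]
  linarith

end KillingFields

section InducedBivector

open VectorField Set Filter Topology

variable
  {E : Type*} [NormedAddCommGroup E] [NormedSpace ℝ E]
  {H : Type*} [TopologicalSpace H] {I : ModelWithCorners ℝ E H}
  {M : Type*} [TopologicalSpace M] [ChartedSpace H M] [IsManifold I ∞ M]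
  {L : Type*} [LieRing L] [LieAlgebra ℝ L]

namespace LieAlgebraAction

variable (Γ : LieAlgebraAction I M L)

/-- The covector on `L` induced by a covector at `x`. -/
noncomputable def pullbackCovector (x : M) (a : TangentSpace I x →L[ℝ] ℝ) : Module.Dual ℝ L :=
  a.toLinearMap ∘ₗ Γ.evalAt x

theorem pullbackCovector_apply (x : M) (a : TangentSpace I x →L[ℝ] ℝ) (u : L) :
    Γ.pullbackCovector x a u = a (Γ.toFun u x) := rfl

theorem sharp_inducedBivector (r : ⋀[ℝ]^2 L) (x : M) (b : TangentSpace I x →L[ℝ] ℝ) :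
    sharp (Γ.inducedBivector r x) (b : Module.Dual ℝ (TangentSpace I x)) =
      Γ.toFun (sharp r (Γ.pullbackCovector x b)) x :=
  sharp_map (Γ.evalAt x) r _

theorem pair_inducedBivector (r : ⋀[ℝ]^2 L) (x : M) (a b : TangentSpace I x →L[ℝ] ℝ) :
    pair (Γ.inducedBivector r x) a b =
      Γ.pullbackCovector x a (sharp r (Γ.pullbackCovector x b)) := by
  rw [pair, sharp_inducedBivector]
  rfl

theorem contMDiffAt_toFun (u : L) (x : M) :
    ContMDiffAt I I.tangent ∞ (T% (fun y ↦ Γ.toFun u y)) x :=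
  (Γ.toFun u).contMDiff x

theorem mdifferentiableAt_toFun (u : L) (x : M) : MDiffAt (T% (fun y ↦ Γ.toFun u y)) x :=
  (Γ.contMDiffAt_toFun u x).mdifferentiableAt (by simp)

/-- The second derivative `(u, v) ↦ Γ(u) (Γ(v) f)` of a smooth function at `x`. -/
noncomputable def secondDeriv {f : M → ℝ} {x : M} (hf : ContMDiffAt I 𝓘(ℝ, ℝ) ∞ f x) :
    L →ₗ[ℝ] L →ₗ[ℝ] ℝ :=
  LinearMap.mk₂ ℝ (fun u v ↦ d% (fun y ↦ d% f y (Γ.toFun v y)) x (Γ.toFun u x))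
    (fun u u' v ↦ by simp)
    (fun c u v ↦ by simp)
    (fun u v v' ↦ by
      simp only [map_add, ContMDiffSection.coe_add, Pi.add_apply]
      rw [mvfderiv_fun_add (mdifferentiableAt_mvfderiv_apply hf (Γ.mdifferentiableAt_toFun v x))
        (mdifferentiableAt_mvfderiv_apply hf (Γ.mdifferentiableAt_toFun v' x))]
      rfl)
    (fun c u v ↦ by
      simp only [map_smul, ContMDiffSection.coe_smul, Pi.smul_apply, smul_eq_mul]
      rw [mvfderiv_fun_mul mdifferentiableAt_const
        (mdifferentiableAt_mvfderiv_apply hf (Γ.mdifferentiableAt_toFun v x)), mvfderiv_const]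
      simp)

theorem secondDeriv_apply {f : M → ℝ} {x : M} (hf : ContMDiffAt I 𝓘(ℝ, ℝ) ∞ f x) (u v : L) :
    Γ.secondDeriv hf u v = d% (fun y ↦ d% f y (Γ.toFun v y)) x (Γ.toFun u x) := rfl

theorem secondDeriv_sub_swap [CompleteSpace E] {f : M → ℝ} {x : M}
    (hf : ContMDiffAt I 𝓘(ℝ, ℝ) ∞ f x) (u v : L) :
    Γ.secondDeriv hf u v - Γ.secondDeriv hf v u = Γ.pullbackCovector x (d% f x) ⁅u, v⁆ := by
  rw [pullbackCovector_apply, Γ.map_lie, mvfderiv_mlieBracket hf (Γ.mdifferentiableAt_toFun u x)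
    (Γ.mdifferentiableAt_toFun v x)]
  rfl

section Expansion

variable {Γ} {r : ⋀[ℝ]^2 L} {n : ℕ} {w u : Fin n → L}

theorem sum_smul_eq_neg_sharp (hs : ∀ β, sharp r β = ∑ j, β (u j) • w j)
    (β : Module.Dual ℝ L) : ∑ j, β (w j) • u j = -sharp r β := by
  rw [← sub_eq_zero, ← Module.forall_dual_apply_eq_zero_iff ℝ]
  intro α
  have h : α (sharp r β) = -β (sharp r α) := pair_swap r α β
  rw [map_sub, map_neg, h, hs α]
  simp [mul_comm]

theorem pair_inducedBivector_eq_sum (hs : ∀ β, sharp r β = ∑ j, β (u j) • w j) (x : M)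
    (a b : TangentSpace I x →L[ℝ] ℝ) :
    pair (Γ.inducedBivector r x) a b = ∑ j, a (Γ.toFun (w j) x) * b (Γ.toFun (u j) x) := by
  rw [pair_inducedBivector, hs]
  simp [pullbackCovector_apply, mul_comm]

theorem bracket_inducedBivector (hs : ∀ β, sharp r β = ∑ j, β (u j) • w j) (f h : M → ℝ) :
    bracket (Γ.inducedBivector r) f h =
      fun x ↦ ∑ j, d% f x (Γ.toFun (w j) x) * d% h x (Γ.toFun (u j) x) :=
  funext fun x ↦ pair_inducedBivector_eq_sum hs x _ _

theorem contMDiffAt_bracket (hs : ∀ β, sharp r β = ∑ j, β (u j) • w j) {f h : M → ℝ} {x : M}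
    (hf : ContMDiffAt I 𝓘(ℝ, ℝ) ∞ f x) (hh : ContMDiffAt I 𝓘(ℝ, ℝ) ∞ h x) :
    ContMDiffAt I 𝓘(ℝ, ℝ) ∞ (bracket (Γ.inducedBivector r) f h) x := by
  rw [bracket_inducedBivector hs]
  exact ContMDiffAt.sum fun j _ ↦
    (contMDiffAt_mvfderiv_apply hf (Γ.contMDiffAt_toFun (w j) x)).mul
      (contMDiffAt_mvfderiv_apply hh (Γ.contMDiffAt_toFun (u j) x))

theorem mvfderiv_bracket (hs : ∀ β, sharp r β = ∑ j, β (u j) • w j) {f h : M → ℝ} {x : M}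
    (hf : ContMDiffAt I 𝓘(ℝ, ℝ) ∞ f x) (hh : ContMDiffAt I 𝓘(ℝ, ℝ) ∞ h x)
    (v : TangentSpace I x) :
    d% (bracket (Γ.inducedBivector r) f h) x v =
      ∑ j, (d% (fun y ↦ d% f y (Γ.toFun (w j) y)) x v * d% h x (Γ.toFun (u j) x) +
        d% f x (Γ.toFun (w j) x) * d% (fun y ↦ d% h y (Γ.toFun (u j) y)) x v) := by
  have hF (j) := mdifferentiableAt_mvfderiv_apply hf (Γ.mdifferentiableAt_toFun (w j) x)
  have hH (j) := mdifferentiableAt_mvfderiv_apply hh (Γ.mdifferentiableAt_toFun (u j) x)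
  have hFH (j) : MDiffAt (fun y ↦ d% f y (Γ.toFun (w j) y) * d% h y (Γ.toFun (u j) y)) x :=
    (hF j).mul (hH j)
  rw [bracket_inducedBivector hs, mvfderiv_fun_sum fun j _ ↦ hFH j, _root_.sum_apply]
  refine Finset.sum_congr rfl fun j _ ↦ ?_
  rw [mvfderiv_fun_mul (hF j) (hH j)]
  simp
  ring

theorem bracket_bracket (hs : ∀ β, sharp r β = ∑ j, β (u j) • w j) (f : M → ℝ) {h k : M → ℝ}
    {x : M} (hh : ContMDiffAt I 𝓘(ℝ, ℝ) ∞ h x) (hk : ContMDiffAt I 𝓘(ℝ, ℝ) ∞ k x) :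
    bracket (Γ.inducedBivector r) f (bracket (Γ.inducedBivector r) h k) x =
      Γ.secondDeriv hk (sharp r (Γ.pullbackCovector x (d% f x)))
          (sharp r (Γ.pullbackCovector x (d% h x))) -
        Γ.secondDeriv hh (sharp r (Γ.pullbackCovector x (d% f x)))
          (sharp r (Γ.pullbackCovector x (d% k x))) := by
  have h₁ : bracket (Γ.inducedBivector r) f (bracket (Γ.inducedBivector r) h k) x =
      -d% (bracket (Γ.inducedBivector r) h k) x
        (Γ.toFun (sharp r (Γ.pullbackCovector x (d% f x))) x) := by
    rw [bracket, pair_swap, pair, sharp_inducedBivector]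
    rfl
  have h₂ := sum_smul_eq_neg_sharp hs (Γ.pullbackCovector x (d% h x))
  rw [h₁, mvfderiv_bracket hs hh hk, Finset.sum_add_distrib, neg_add',
    ← neg_neg (sharp r (Γ.pullbackCovector x (d% h x))), ← h₂,
    hs (Γ.pullbackCovector x (d% k x))]
  simp only [map_neg, map_sum, map_smul, smul_eq_mul, secondDeriv_apply, pullbackCovector_apply]
  simp only [mul_comm]
  ring

/-- The Jacobi identity for the bivector induced by a solution of the Yang-Baxter equation. -/
theorem jacobi_inducedBivector [CompleteSpace E] (hr : IsYangBaxter r)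
    (hs : ∀ β, sharp r β = ∑ j, β (u j) • w j) {f h k : M → ℝ} {x : M}
    (hf : ContMDiffAt I 𝓘(ℝ, ℝ) ∞ f x) (hh : ContMDiffAt I 𝓘(ℝ, ℝ) ∞ h x)
    (hk : ContMDiffAt I 𝓘(ℝ, ℝ) ∞ k x) :
    bracket (Γ.inducedBivector r) f (bracket (Γ.inducedBivector r) h k) x +
      bracket (Γ.inducedBivector r) h (bracket (Γ.inducedBivector r) k f) x +
      bracket (Γ.inducedBivector r) k (bracket (Γ.inducedBivector r) f h) x = 0 := by
  rw [bracket_bracket hs f hh hk, bracket_bracket hs h hk hf, bracket_bracket hs k hf hh]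
  have key := hr (Γ.pullbackCovector x (d% f x)) (Γ.pullbackCovector x (d% h x))
    (Γ.pullbackCovector x (d% k x))
  simp only [← secondDeriv_sub_swap Γ hf, ← secondDeriv_sub_swap Γ hh,
    ← secondDeriv_sub_swap Γ hk] at key
  linarith

theorem isPoissonTensor_inducedBivector [CompleteSpace E] (hr : IsYangBaxter r)
    (hs : ∀ β, sharp r β = ∑ j, β (u j) • w j) : IsPoissonTensor (Γ.inducedBivector r) where
  smooth _ hU _ _ hf hh _ hx :=
    (contMDiffAt_bracket hs (hf.contMDiffAt (hU.mem_nhds hx))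
      (hh.contMDiffAt (hU.mem_nhds hx))).contMDiffWithinAt
  jacobi _ _ _ hf hh hk x := jacobi_inducedBivector hr hs (hf x) (hh x) (hk x)

/-- The bilinear map `(u, v) ↦ b (∇_{Γ(u)} Γ(v))` for a covector `b` at `x`. -/
noncomputable def covDerivForm (Γ : LieAlgebraAction I M L)
    (cov : CovariantDerivative I E (TangentSpace I : M → Type _)) (x : M)
    (b : TangentSpace I x →L[ℝ] ℝ) : L →ₗ[ℝ] L →ₗ[ℝ] ℝ :=
  LinearMap.mk₂ ℝ (fun u v ↦ b (cov (fun y ↦ Γ.toFun v y) x (Γ.toFun u x)))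
    (fun u u' v ↦ by simp)
    (fun c u v ↦ by simp)
    (fun u v v' ↦ by
      have h : (fun y ↦ Γ.toFun (v + v') y) =
          (fun y ↦ Γ.toFun v y) + fun y ↦ Γ.toFun v' y := by ext y; simp
      rw [h, cov.isCovariantDerivativeOnUniv.add (Γ.mdifferentiableAt_toFun v x)
        (Γ.mdifferentiableAt_toFun v' x)]
      simp)
    (fun c u v ↦ by
      have h : (fun y ↦ Γ.toFun (c • v) y) = (fun _ : M ↦ c) • fun y ↦ Γ.toFun v y := by ext y; simp
      rw [h, cov.isCovariantDerivativeOnUniv.leibniz (Γ.mdifferentiableAt_toFun v x)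
        mdifferentiableAt_const, mvfderiv_const]
      simp)

theorem covDerivForm_apply (cov : CovariantDerivative I E (TangentSpace I : M → Type _)) (x : M)
    (b : TangentSpace I x →L[ℝ] ℝ) (p q : L) :
    Γ.covDerivForm cov x b p q = b (cov (fun y ↦ Γ.toFun q y) x (Γ.toFun p x)) := rfl

variable [FiniteDimensional ℝ E]
  {g : ContMDiffRiemannianMetric I ∞ E (fun x : M ↦ TangentSpace I x)}

theorem covDerivBivector_inducedBivector (hs : ∀ β, sharp r β = ∑ j, β (u j) • w j)
    (cov : CovariantDerivative I E (TangentSpace I : M → Type _)) (x : M) (v : TangentSpace I x)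
    (a b : TangentSpace I x →L[ℝ] ℝ) :
    covDerivBivector cov (Γ.inducedBivector r) x v a b =
      ∑ j, (a (cov (fun y ↦ Γ.toFun (w j) y) x v) * b (Γ.toFun (u j) x) +
        a (Γ.toFun (w j) x) * b (cov (fun y ↦ Γ.toFun (u j) y) x v)) := by
  have hd (c : TangentSpace I x →L[ℝ] ℝ) (p : L) :=
    mdifferentiableAt_extendCovector c (Γ.mdifferentiableAt_toFun p x)
  have hc (c : TangentSpace I x →L[ℝ] ℝ) (p : L) :=
    covDerivOneForm_apply cov v (fun Y hY ↦ mdifferentiableAt_extendCovector c hY)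
      (Γ.mdifferentiableAt_toFun p x)
  simp only [covDerivBivector, pair_inducedBivector_eq_sum hs, hc, extendCovector_self]
  have hab (j) : MDiffAt (fun y ↦ extendCovector a y (Γ.toFun (w j) y) *
      extendCovector b y (Γ.toFun (u j) y)) x := (hd a (w j)).mul (hd b (u j))
  rw [mvfderiv_fun_sum fun j _ ↦ hab j, _root_.sum_apply,
    ← Finset.sum_sub_distrib, ← Finset.sum_sub_distrib]
  refine Finset.sum_congr rfl fun j _ ↦ ?_
  rw [mvfderiv_fun_mul (hd a (w j)) (hd b (u j))]
  simp [extendCovector_self]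
  ring

theorem divergence_inducedBivector (hs : ∀ β, sharp r β = ∑ j, β (u j) • w j)
    (hswap : ∀ B : L →ₗ[ℝ] L →ₗ[ℝ] ℝ, ∑ j, B (w j) (u j) = -∑ j, B (u j) (w j))
    (hlie : ∑ j, ⁅w j, u j⁆ = 0)
    (hK : ∀ p : L, IsKillingField g (fun x ↦ Γ.toFun p x)) (x : M)
    (b : TangentSpace I x →L[ℝ] ℝ) :
    divergence (leviCivita g) (Γ.inducedBivector r) x b = 0 := by
  have : T2Space (TangentSpace I x) := inferInstanceAs (T2Space E)
  let e := Module.finBasis ℝ (TangentSpace I x)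
  have htr (j) : ∑ i, e.coord i (leviCivita g (fun y ↦ Γ.toFun (w j) y) x (e i)) = 0 := by
    have h := (hK (w j)).trace_leviCivita (Γ.mdifferentiableAt_toFun (w j) x)
    rw [LinearMap.trace_eq_matrix_trace ℝ e, Matrix.trace] at h
    rw [← h]
    exact Finset.sum_congr rfl fun i _ ↦ by simp [LinearMap.toMatrix_apply]
  have hcontr (j) : ∑ i, e.coord i (Γ.toFun (w j) x) *
      b (leviCivita g (fun y ↦ Γ.toFun (u j) y) x (e i)) =
        Γ.covDerivForm (leviCivita g) x b (w j) (u j) := by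
    rw [covDerivForm_apply]
    conv_rhs => rw [← e.sum_repr (Γ.toFun (w j) x)]
    simp only [map_sum, map_smul, smul_eq_mul, Module.Basis.coord_apply]
  have hzero : ∑ j, Γ.covDerivForm (leviCivita g) x b (w j) (u j) = 0 := by
    have h₁ := hswap (Γ.covDerivForm (leviCivita g) x b)
    have h₂ : ∑ j, Γ.covDerivForm (leviCivita g) x b (w j) (u j) -
        ∑ j, Γ.covDerivForm (leviCivita g) x b (u j) (w j) = 0 := by
      rw [← Finset.sum_sub_distrib, ← map_zero (Γ.pullbackCovector x b), ← hlie, map_sum]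
      refine Finset.sum_congr rfl fun j _ ↦ ?_
      rw [pullbackCovector_apply, Γ.map_lie, ← leviCivita_torsionFree g
        (Γ.mdifferentiableAt_toFun (w j) x) (Γ.mdifferentiableAt_toFun (u j) x), map_sub]
      rfl
    linarith
  simp only [divergence, covDerivBivector_inducedBivector hs]
  rw [Finset.sum_comm, ← hzero]
  refine Finset.sum_congr rfl fun j _ ↦ ?_
  rw [Finset.sum_add_distrib, ← Finset.sum_mul]
  refine (congrArg₂ (· + ·) (congrArg (· * _) (htr j)) (hcontr j)).trans ?_
  simp

theorem lieDerivBivector_gradient_casimir (hfree : Γ.IsLocallyFree)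
    (hs : ∀ β, sharp r β = ∑ j, β (u j) • w j)
    (hw : ∀ j, w j ∈ LinearMap.range (sharp r)) (hu : ∀ j, u j ∈ LinearMap.range (sharp r))
    (hK : ∀ p : L, IsKillingField g (fun x ↦ Γ.toFun p x)) {f h k : M → ℝ} {x : M}
    (hf : ContMDiffAt I 𝓘(ℝ, ℝ) ∞ f x) (hh : ContMDiffAt I 𝓘(ℝ, ℝ) ∞ h x)
    (hk : ContMDiffAt I 𝓘(ℝ, ℝ) ∞ k x)
    (hcas : ∀ᶠ y in 𝓝 x, hamiltonian (Γ.inducedBivector r) f y = 0) :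
    lieDerivBivector (gradient g f) (Γ.inducedBivector r) h k x = 0 := by
  have := FiniteDimensional.complete ℝ E
  have hinv (p : L) (hp : p ∈ LinearMap.range (sharp r)) :
      ∀ᶠ y in 𝓝 x, d% f y (Γ.toFun p y) = 0 := by
    obtain ⟨β, rfl⟩ := hp
    filter_upwards [hcas] with y hy
    have h₁ : sharp r (Γ.pullbackCovector y (d% f y)) = 0 := by
      apply hfree y
      rw [map_zero, ← neg_eq_zero, ← hy, hamiltonian, sharp_inducedBivector]
      rfl
    have h₂ := pair_swap r (Γ.pullbackCovector y (d% f y)) β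
    rw [pair, pair, h₁, map_zero, neg_zero] at h₂
    exact h₂
  have hcomm (p : L) (hp : p ∈ LinearMap.range (sharp r)) {q : M → ℝ}
      (hq : ContMDiffAt I 𝓘(ℝ, ℝ) ∞ q x) :
      d% (fun y ↦ d% q y (gradient g f y)) x (Γ.toFun p x) =
        d% (fun y ↦ d% q y (Γ.toFun p y)) x (gradient g f x) := by
    have h₁ := mvfderiv_mlieBracket hq (Γ.mdifferentiableAt_toFun p x)
      (mdifferentiableAt_gradient g hf)
    rw [(hK p).mlieBracket_gradient (Γ.mdifferentiableAt_toFun p x) hf (hinv p hp), map_zero] at h₁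
    linarith
  rw [lieDerivBivector, mvfderiv_bracket hs hh hk]
  simp only [bracket_inducedBivector hs, hcomm _ (hw _) hh, hcomm _ (hu _) hk]
  rw [← Finset.sum_sub_distrib, ← Finset.sum_sub_distrib]
  exact Finset.sum_eq_zero fun j _ ↦ by ring

end Expansion

end LieAlgebraAction

end InducedBivector

end KillingPoisson

theorem theorem1p4
    {E : Type*} [NormedAddCommGroup E] [NormedSpace ℝ E] [FiniteDimensional ℝ E]
    {H : Type*} [TopologicalSpace H] {I : ModelWithCorners ℝ E H}
    {M : Type*} [TopologicalSpace M] [T2Space M] [ChartedSpace H M] [IsManifold I ∞ M]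
    [BoundarylessManifold I M]
    (g : ContMDiffRiemannianMetric I ∞ E (fun x : M ↦ TangentSpace I x))
    {L : Type*} [LieRing L] [LieAlgebra ℝ L]
    (r : ⋀[ℝ]^2 L) (hr : KillingPoisson.IsYangBaxter r)
    (hu : KillingPoisson.IsUnimodularLieAlgebra (KillingPoisson.imageSubalgebra r hr))
    (Γ : KillingPoisson.LieAlgebraAction I M L) (hfree : Γ.IsLocallyFree)
    (hK : ∀ u : L, KillingPoisson.IsKillingField g (fun x ↦ Γ.toFun u x)) :
    KillingPoisson.IsKillingPoisson g (Γ.inducedBivector r) := by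
  have := FiniteDimensional.complete ℝ E
  obtain ⟨n, w, u, hw, hu, hs, hlie, hswap⟩ := hr.exists_expansion hu
  exact
    { poisson := Γ.isPoissonTensor_inducedBivector hr hs
      divergence_eq_zero := Γ.divergence_inducedBivector hs hswap hlie hK
      lieDeriv_gradient_casimir := fun U hU f hf hcas h k hh hk x hx ↦
        have hUx := hU.mem_nhds hx
        Γ.lieDerivBivector_gradient_casimir hfree hs hw hu hK (hf.contMDiffAt hUx)
          (hh.contMDiffAt hUx) (hk.contMDiffAt hUx) (Filter.mem_of_superset hUx hcas) }
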